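/- Let $S_0,S_1,S_2,S_3\subset\mathbb{R}^3$ be four spheres with radii $r_0,r_1,r_2,r_3>0$, any two of which are externally tangent, and suppose that their centers $v_0,v_1,v_2,v_3$ are affinely independent, so that they are the vertices of a (nondegenerate) tetrahedron $T$. Then there is exactly one sphere (of positive radius) that is tangent to all six edges of $T$, i.e. tangent to the line $v_iv_j$ at a point of the segment $[v_i,v_j]$ for all $i\neq j$. Let $C$ be its center, and take $C$ as the center of the duality structure on $T$: - for a face $\sigma$ of $T$ let $C_\sigma$ be the orthogonal projection of $C$ onto the affine span of $\sigma$ (so $C_T=C$); for a face $\tau$ of codimension one in a face $\sigma$, let $\ell^*(\tau\subset\sigma)=\pm\|C_\sigma-C_\tau\|$, with sign $+$ if $C_\sigma$ lies on the same side of $\tau$ as $\sigma$ and $-$ if it lies on the opposite side; - let $\ell^*_{ij}=\tfrac12\sum_{k\neq i,j}\ell^*([i,j]\subset[i,j,k])\,\ell^*([i,j,k]\subset T)$ be the dual area of the edge $[i,j]$, and $w_{ij}=\ell^*_{ij}/\|v_i-v_j\|$; - let $L$ be the $4\times 4$ matrix of the Laplacian $(Lf)_i=\sum_{j\ne i}w_{ij}(f_j-f_i)$,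 and let the Laplacian determinant $K^*(T)$ be the determinant of $-L$ with its first row and first column (those of vertex $0$) removed. Then $$K^*(T)=\frac{36\,r_0r_1r_2r_3\operatorname{Vol}(T)}{P_{123}P_{023}P_{013}P_{012}},$$ where $\operatorname{Vol}(T)>0$ is the volume of $T$ and $P_{ijk}=\|v_i-v_j\|+\|v_j-v_k\|+\|v_k-v_i\|$ is the perimeter of the face $[i,j,k]$. -/

import Mathlib

open EuclideanGeometry

noncomputable section

namespace SpherePacking

/-- Euclidean three-space. -/
abbrev Space := EuclideanSpace ℝ (Fin 3)

/-- The affine subspace spanned by the face `σ` of the tetrahedron with vertices `v`. -/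
def faceSpan (v : Fin 4 → Space) (σ : Finset (Fin 4)) : AffineSubspace ℝ Space :=
  affineSpan ℝ (v '' (σ : Set (Fin 4)))

lemma faceSpan_nonempty (v : Fin 4 → Space) {σ : Finset (Fin 4)} (h : σ.Nonempty) :
    Nonempty (faceSpan v σ) :=
  let ⟨i, hi⟩ := h
  ⟨⟨v i, subset_affineSpan ℝ _ ⟨i, hi, rfl⟩⟩⟩

/-- The center `C_σ` of the (nonempty) face `σ`: the orthogonal projection of the chosen center `C`
of the tetrahedron onto the affine subspace spanned by `σ`. (For `σ = ∅` the value is irrelevant.) -/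
def faceCenter (v : Fin 4 → Space) (C : Space) (σ : Finset (Fin 4)) : Space :=
  if h : σ.Nonempty then
    haveI := faceSpan_nonempty v h
    (orthogonalProjection (faceSpan v σ) C : Space)
  else C

open Classical in
/-- The dual length `ℓ*(τ ⊂ σ)`, for a face `τ` of codimension one in the face `σ`: the distance from
`C_τ` to `C_σ`, with sign `+` if `C_σ` lies on the same side of `τ` as `σ` (that is, as the vertex
of `σ` that is not in `τ`), and sign `-` otherwise. -/
def dualLength (v : Fin 4 → Space) (C : Space) (τ σ : Finset (Fin 4)) : ℝ :=
  if ∀ k ∈ σ \ τ, (faceSpan v τ).SSameSide (faceCenter v C σ) (v k) then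
    dist (faceCenter v C σ) (faceCenter v C τ)
  else
    -dist (faceCenter v C σ) (faceCenter v C τ)

/-- The dual area `ℓ*_{ij} = A*([i,j])` of the edge `[i,j]`: half the sum of
`ℓ*([i,j] ⊂ [i,j,k]) ℓ*([i,j,k] ⊂ T)` over the two triangles `[i,j,k]` that contain `[i,j]`. -/
def dualArea (v : Fin 4 → Space) (C : Space) (i j : Fin 4) : ℝ :=
  (∑ k ∈ Finset.univ \ {i, j},
    dualLength v C {i, j} {i, j, k} * dualLength v C {i, j, k} Finset.univ) / 2

/-- The weight `w_{ij} = ℓ*_{ij} / ℓ_{ij}` of the edge `[i,j]`. -/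
def edgeWeight (v : Fin 4 → Space) (C : Space) (i j : Fin 4) : ℝ :=
  dualArea v C i j / dist (v i) (v j)

/-- The matrix of the Laplacian `(L f)_i = ∑_{j ≠ i} w_{ij} (f_j - f_i)`. -/
def laplacian (v : Fin 4 → Space) (C : Space) : Matrix (Fin 4) (Fin 4) ℝ :=
  Matrix.of fun i j =>
    if i = j then -∑ k ∈ Finset.univ \ {i}, edgeWeight v C i k else edgeWeight v C i j

/-- The Laplacian determinant `K*(T)`: the determinant of `-L` with its first row and first column
removed. -/
def laplacianDet (v : Fin 4 → Space) (C : Space) : ℝ :=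
  (-((laplacian v C).submatrix Fin.succ Fin.succ)).det

/-- `M` is a sphere tangent to all six edges of the tetrahedron with vertices `v` (each edge line is
tangent to `M` at a point of the edge). -/
def IsEdgeTangentSphere (v : Fin 4 → Space) (M : Sphere Space) : Prop :=
  0 < M.radius ∧
    ∀ i j, i ≠ j → ∃ p ∈ segment ℝ (v i) (v j), M.IsTangentAt p line[ℝ, v i, v j]

/-- The volume of the tetrahedron with vertices `v`. -/
def tetVolume (v : Fin 4 → Space) : ℝ :=
  MeasureTheory.volume.real (convexHull ℝ (Set.range v))

/-- The perimeter `P_{ijk}` of the face `[i,j,k]`. -/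
def perimeter (v : Fin 4 → Space) (i j k : Fin 4) : ℝ :=
  dist (v i) (v j) + dist (v j) (v k) + dist (v k) (v i)

end SpherePacking

end

/-!
Put `κ i = 1 / r i`, `K = ∑ κ i`, `D = K² - 2 ∑ (κ i)²` and `P = ∏ r i`. All the centres of the duality
structure are points of constant power with respect to the spheres at the vertices of their face
(`HasPower`): the edge `[i,j]` has the point of tangency of the spheres `i` and `j`, with power `0`; a
face has its incentre, with power the squared inradius; and the tetrahedron has the radical centre
`∑ λ i • v i`, where `λ i = κ i (K - 2 κ i) / D`, with power `4 / D`. Points of constant power over a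
face project to one another (`HasPower.faceCenter_eq`), and their squared distances are differences
of powers (`HasPower.dist_sq_eq`).

A sphere tangent to the edges must have tangent length `r i` from the vertex `v i`, so its centre is
the radical centre and its squared radius is the power `4 / D`; this gives existence and uniqueness.
The positivity of `D` comes from the Gram determinant of the tetrahedron, `36 V² = 4 P² D`.

For the determinant, the inradius of the face opposite to `l` times the signed height of the centre
over it is `λ l P √D / s l`, where `s l` is the half-perimeter of that face
(`dualLength_mul_dualLength`); the sign of the height is that of `λ l`. So
`w i j = P √D / (2 D) * (m k + m l) / (r i + r j)` with `m l = κ l (K - 2 κ l) / s l` and `{k, l}` the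
complement of `{i, j}` (`edgeWeight_eq`), and the claim becomes a rational identity in the four
radii, `minorPoly_eq`.
-/

noncomputable section

namespace SpherePacking

/-! ### Points of equal power and dual lengths -/

/-- `p` has the same power `c` with respect to each of the spheres of radius `r i` centred at `v i`,
for the vertices `i` of the face `σ`. -/
def HasPower (v : Fin 4 → Space) (r : Fin 4 → ℝ) (σ : Finset (Fin 4)) (p : Space) (c : ℝ) : Prop :=
  ∀ i ∈ σ, dist p (v i) ^ 2 = r i ^ 2 + c

lemma HasPower.mono {v : Fin 4 → Space} {r : Fin 4 → ℝ} {σ τ : Finset (Fin 4)} {p : Space} {c : ℝ}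
    (h : HasPower v r σ p c) (hτ : τ ⊆ σ) : HasPower v r τ p c :=
  fun i hi => h i (hτ hi)

/-- The difference of two points with equal power differences at `x` and `y` is orthogonal to the
line `xy`: both lie on the radical hyperplane. -/
lemma inner_sub_sub_eq_zero {p q x y : Space} {a b c c' : ℝ}
    (hpx : dist p x ^ 2 = a + c) (hpy : dist p y ^ 2 = b + c)
    (hqx : dist q x ^ 2 = a + c') (hqy : dist q y ^ 2 = b + c') :
    inner ℝ (x - y) (p - q) = 0 := by
  have key : 2 * inner ℝ (x - y) (p - q) =
      dist p y ^ 2 - dist p x ^ 2 - (dist q y ^ 2 - dist q x ^ 2) := by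
    simp only [dist_eq_norm, ← real_inner_self_eq_norm_sq, inner_sub_left, inner_sub_right,
      real_inner_comm]
    ring
  linarith

lemma vertex_mem_faceSpan (v : Fin 4 → Space) {σ : Finset (Fin 4)} {i : Fin 4} (hi : i ∈ σ) :
    v i ∈ faceSpan v σ :=
  subset_affineSpan ℝ _ ⟨i, hi, rfl⟩

section
variable {v : Fin 4 → Space} {r : Fin 4 → ℝ} {σ τ : Finset (Fin 4)} {p q : Space} {c c' : ℝ}

/-- The points of constant power over a face lie on one common perpendicular to that face. -/
lemma HasPower.sub_mem_direction_orthogonal (hp : HasPower v r σ p c) (hq : HasPower v r σ q c') :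
    p - q ∈ (faceSpan v σ).directionᗮ := by
  rw [faceSpan, direction_affineSpan, vectorSpan_def, Submodule.mem_orthogonal]
  intro u hu
  induction hu using Submodule.span_induction with
  | mem u hu =>
    obtain ⟨_, ⟨i, hi, rfl⟩, _, ⟨j, hj, rfl⟩, rfl⟩ := hu
    exact inner_sub_sub_eq_zero (hp i hi) (hp j hj) (hq i hi) (hq j hj)
  | zero => simp
  | add x y _ _ hx hy => rw [inner_add_left, hx, hy, add_zero]
  | smul a x _ hx => rw [inner_smul_left, hx, mul_zero]

lemma HasPower.faceCenter_eq (hσ : σ.Nonempty) (hp : HasPower v r σ p c) (hq : HasPower v r σ q c')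
    (hpσ : p ∈ faceSpan v σ) : faceCenter v q σ = p := by
  have := faceSpan_nonempty v hσ
  rw [faceCenter, dif_pos hσ, coe_orthogonalProjection_eq_iff_mem]
  exact ⟨hpσ, hq.sub_mem_direction_orthogonal hp⟩

/-- The Pythagorean theorem, as both powers are taken with respect to the same spheres. -/
lemma HasPower.dist_sq_eq (hσ : σ.Nonempty) (hp : HasPower v r σ p c) (hq : HasPower v r σ q c')
    (hpσ : p ∈ faceSpan v σ) : dist q p ^ 2 = c' - c := by
  obtain ⟨i, hi⟩ := hσ
  have h := (Submodule.mem_orthogonal _ _).1 (hq.sub_mem_direction_orthogonal hp) (p - v i)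
    ((faceSpan v σ).vsub_mem_direction hpσ (vertex_mem_faceSpan v hi))
  have key : dist q (v i) ^ 2 = dist q p ^ 2 + dist p (v i) ^ 2 + 2 * inner ℝ (p - v i) (q - p) := by
    simp only [dist_eq_norm, ← real_inner_self_eq_norm_sq, inner_sub_left, inner_sub_right,
      real_inner_comm]
    ring
  linarith [hp i hi, hq i hi]

/-- The sign in the dual length is the sign of the barycentric coordinate `t` of the centre of `σ` at
the vertex `v k` opposite to `τ`. -/
lemma dualLength_of_pos (hT : AffineIndependent ℝ v) {k : Fin 4} (hk : k ∉ τ)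
    {C x y : Space} {t : ℝ} (hσ : σ = insert k τ)
    (hx : x ∈ faceSpan v τ) (hy : y ∈ faceSpan v τ)
    (hC : faceCenter v C σ = t • (v k - x) + y) :
    dualLength v C τ σ = if 0 < t then dist (faceCenter v C σ) (faceCenter v C τ)
      else -dist (faceCenter v C σ) (faceCenter v C τ) := by
  have hk' : v k ∉ faceSpan v τ := by
    rw [faceSpan, hT.mem_affineSpan_iff]
    simpa using hk
  have hdiff : σ \ τ = {k} := by
    rw [hσ]; exact Finset.insert_sdiff_cancel hk
  have hiff : (∀ k ∈ σ \ τ, (faceSpan v τ).SSameSide (faceCenter v C σ) (v k)) ↔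
      (faceSpan v τ).SSameSide (faceCenter v C σ) (v k) := by
    simp [hdiff]
  suffices h : (faceSpan v τ).SSameSide (faceCenter v C σ) (v k) ↔ 0 < t by
    simp only [dualLength, hiff, h]
  constructor
  · intro h
    by_contra! ht
    rw [hC] at h
    rcases ht.lt_or_eq with ht | rfl
    · exact (AffineSubspace.sOppSide_smul_vsub_vadd_left hk' hx hy ht).not_sSameSide h
    · rw [zero_smul, zero_add] at h
      exact h.left_notMem hy
  · intro ht
    rw [hC]
    exact AffineSubspace.sSameSide_smul_vsub_vadd_left hk' hx hy ht

/-- The dual length as a signed quantity, from the powers `c'` and `d` of the centres `p` of `σ` and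
`q` of `τ`: `c' - d` is its square, and the barycentric coordinate `t` of `p` carries its sign. -/
lemma dualLength_eq (hT : AffineIndependent ℝ v) {k : Fin 4} (hk : k ∉ τ) (hτ : τ.Nonempty)
    {C x y : Space} {t g : ℝ} (hσ : σ = insert k τ)
    (hC : HasPower v r σ C c)
    (hp : HasPower v r σ p c') (hpσ : p ∈ faceSpan v σ)
    {d : ℝ} (hq : HasPower v r τ q d) (hqτ : q ∈ faceSpan v τ)
    (hx : x ∈ faceSpan v τ) (hy : y ∈ faceSpan v τ)
    (hpt : p = t • (v k - x) + y) (hg : 0 ≤ g) (ht : c' - d = (t * g) ^ 2) :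
    dualLength v C τ σ = t * g := by
  have hτσ : τ ⊆ σ := by rw [hσ]; exact Finset.subset_insert _ _
  have hCσ := hp.faceCenter_eq (hτ.mono hτσ) hC hpσ
  have hCτ := hq.faceCenter_eq hτ (hC.mono hτσ) hqτ
  have hd := hq.dist_sq_eq hτ (hp.mono hτσ) hqτ
  rw [dualLength_of_pos hT hk hσ hx hy (hCσ.trans hpt), hCσ, hCτ]
  rw [ht, sq_eq_sq_iff_abs_eq_abs, abs_of_nonneg dist_nonneg, abs_mul, abs_of_nonneg hg] at hd
  split_ifs with h
  · rw [hd, abs_of_pos h]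
  · rw [hd, abs_of_nonpos (not_lt.1 h), neg_mul, neg_neg]

end

/-! ### The volume of a tetrahedron -/

open MeasureTheory

/-- The simplex `{x | 0 ≤ x i, ∑ x i ≤ t}` in `ℝⁿ`, cut off from the positive orthant. -/
def cornerSimplex (n : ℕ) (t : ℝ) : Set (Fin n → ℝ) := {x | (∀ i, 0 ≤ x i) ∧ ∑ i, x i ≤ t}

lemma isClosed_cornerSimplex (n : ℕ) (t : ℝ) : IsClosed (cornerSimplex n t) := by
  refine IsClosed.inter (s₁ := {x : Fin n → ℝ | ∀ i, 0 ≤ x i})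
    (s₂ := {x : Fin n → ℝ | ∑ i, x i ≤ t}) ?_ ?_
  · simp only [Set.ofPred_forall]
    exact isClosed_iInter fun i => isClosed_le continuous_const (continuous_apply i)
  · exact isClosed_le (by fun_prop) continuous_const

/-- By induction on `n`: the slice at the first coordinate `x` is the corner simplex of size `t - x`
in one dimension less. -/
lemma volume_cornerSimplex (n : ℕ) {t : ℝ} (ht : 0 ≤ t) :
    volume (cornerSimplex n t) = ENNReal.ofReal (t ^ n / n.factorial) := by
  induction n generalizing t with
  | zero =>
    have : cornerSimplex 0 t = Set.univ := by ext x; simp [cornerSimplex, ht]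
    simp [this, volume_pi]
  | succ n ih =>
    have hmp := (volume_preserving_piFinSuccAbove (fun _ : Fin (n + 1) => ℝ) 0).symm
    rw [← hmp.measure_preimage_equiv, Measure.volume_eq_prod, Measure.prod_apply]
    · have hslice : ∀ x : ℝ, volume (Prod.mk x ⁻¹'
          ((MeasurableEquiv.piFinSuccAbove (fun _ : Fin (n + 1) => ℝ) 0).symm ⁻¹'
            cornerSimplex (n + 1) t)) =
          (Set.Icc 0 t).indicator (fun x => ENNReal.ofReal ((t - x) ^ n / n.factorial)) x := by
        intro x
        by_cases hx : x ∈ Set.Icc 0 t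
        · rw [Set.indicator_of_mem hx, ← ih (sub_nonneg.2 hx.2)]
          congr 1
          ext y
          simp [cornerSimplex, Fin.forall_fin_succ, Fin.sum_univ_succ, hx.1, le_sub_iff_add_le']
        · rw [Set.indicator_of_notMem hx]
          convert measure_empty (μ := volume)
          ext y
          simp only [cornerSimplex, Fin.forall_fin_succ, Fin.sum_univ_succ, Set.mem_preimage,
            Set.mem_ofPred_eq, Set.mem_empty_iff_false, iff_false, not_and,
            MeasurableEquiv.piFinSuccAbove_symm_apply, Fin.insertNthEquiv_zero,
            Fin.consEquiv_apply, Fin.cons_zero, Fin.cons_succ, not_le, and_imp]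
          intro h0 h1
          by_contra! h
          exact hx ⟨h0, by linarith [Finset.sum_nonneg fun i (_ : i ∈ Finset.univ) => h1 i]⟩
      simp_rw [hslice]
      rw [lintegral_indicator measurableSet_Icc,
        ← ofReal_integral_eq_lintegral_ofReal]
      · congr 1
        rw [integral_Icc_eq_integral_Ioc, ← intervalIntegral.integral_of_le ht,
          intervalIntegral.integral_div,
          intervalIntegral.integral_comp_sub_left (fun x => x ^ n) t, integral_pow,
          Nat.factorial_succ]
        push_cast
        have : ((n : ℝ) + 1) ≠ 0 := by positivity
        have : (n.factorial : ℝ) ≠ 0 := by positivity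
        simp
        field_simp
      · exact (Continuous.integrableOn_Icc (by fun_prop))
      · refine (ae_restrict_iff' measurableSet_Icc).2 (Filter.Eventually.of_forall fun x hx => ?_)
        have := sub_nonneg.2 hx.2
        simp only [Pi.zero_apply]
        positivity
    · exact (MeasurableEquiv.measurable _) (isClosed_cornerSimplex _ _).measurableSet

/-- The linear map sending the standard basis to the edge vectors at the vertex `v 0`. -/
def edgeMap (v : Fin 4 → Space) : Space →ₗ[ℝ] Space :=
  Matrix.toLin (EuclideanSpace.basisFun (Fin 3) ℝ).toBasis (EuclideanSpace.basisFun (Fin 3) ℝ).toBasis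
    (Matrix.of fun a i : Fin 3 => (v i.succ - v 0) a)

lemma edgeMap_apply (v : Fin 4 → Space) (x : Space) :
    edgeMap v x = ∑ i : Fin 3, x i • (v i.succ - v 0) := by
  ext a
  fin_cases a <;>
  simp [edgeMap, Matrix.toLin_apply, Matrix.mulVec, dotProduct, Fin.sum_univ_three, mul_comm]

lemma convexHull_range_eq_image (v : Fin 4 → Space) :
    convexHull ℝ (Set.range v) =
      (fun x => v 0 + x) '' (edgeMap v '' ((MeasurableEquiv.toLp 2 (Fin 3 → ℝ)).symm ⁻¹'
        cornerSimplex 3 1)) := by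
  have hL : Set.range v = Fintype.linearCombination ℝ v '' Set.range fun i => Pi.single i 1 := by
    rw [← Set.range_comp]
    congr 1
    ext1 i
    simp
  rw [hL, ← LinearMap.image_convexHull, convexHull_rangle_single_eq_stdSimplex]
  ext p
  simp only [Set.mem_image, Set.mem_preimage, exists_exists_and_eq_and,
    Fintype.linearCombination_apply]
  constructor
  · rintro ⟨w, ⟨hw0, hw1⟩, rfl⟩
    rw [Fin.sum_univ_succ] at hw1
    refine ⟨WithLp.toLp 2 fun i : Fin 3 => w i.succ, ⟨fun i => hw0 _, ?_⟩, ?_⟩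
    · change ∑ i : Fin 3, w i.succ ≤ 1
      linarith [hw0 0]
    · rw [edgeMap_apply, Fin.sum_univ_succ (n := 3)]
      simp only [smul_sub, Finset.sum_sub_distrib, ← Finset.sum_smul, eq_sub_of_add_eq' hw1,
        sub_smul, one_smul]
      abel
  · rintro ⟨x, ⟨hx0, hx1⟩, rfl⟩
    refine ⟨Fin.cons (1 - ∑ i, x i) x, ⟨?_, ?_⟩, ?_⟩
    · intro i
      refine Fin.cases ?_ (fun j => ?_) i
      · simpa using hx1
      · simpa using hx0 j
    · simp [Fin.sum_univ_succ]
    · rw [edgeMap_apply, Fin.sum_univ_succ (n := 3)]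
      simp only [smul_sub, Finset.sum_sub_distrib, ← Finset.sum_smul, Fin.cons_zero, Fin.cons_succ,
        sub_smul, one_smul]
      abel

/-- The volume of a tetrahedron in terms of the Gram determinant of its edge vectors at `v 0`. -/
lemma tetVolume_sq (v : Fin 4 → Space) :
    36 * tetVolume v ^ 2 =
      (Matrix.of fun i j : Fin 3 => inner ℝ (v i.succ - v 0) (v j.succ - v 0)).det := by
  have hdet : LinearMap.det (edgeMap v) =
      (Matrix.of fun a i : Fin 3 => (v i.succ - v 0) a).det := by
    rw [edgeMap, LinearMap.det_toLin]
  have hgram : (Matrix.of fun i j : Fin 3 => inner ℝ (v i.succ - v 0) (v j.succ - v 0)) =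
      (Matrix.of fun a i : Fin 3 => (v i.succ - v 0) a).transpose *
        (Matrix.of fun a i : Fin 3 => (v i.succ - v 0) a) := by
    ext i j
    simp [Matrix.mul_apply, PiLp.inner_apply, mul_comm]
  rw [hgram, Matrix.det_mul, Matrix.det_transpose, ← hdet, tetVolume, convexHull_range_eq_image,
    Measure.real, Set.image_add_left, measure_preimage_add, Measure.addHaar_image_linearMap,
    (EuclideanSpace.volume_preserving_symm_measurableEquiv_toLp (Fin 3)).measure_preimage_equiv,
    volume_cornerSimplex 3 zero_le_one, ← ENNReal.ofReal_mul (abs_nonneg _),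
    ENNReal.toReal_ofReal (by positivity), mul_pow, sq_abs]
  norm_num [Nat.factorial]
  ring

/-! ### Rational identities in the radii -/

/-- The power of `midCenter` with respect to the sphere of radius `a`, as a rational identity in the
four radii; `x`, `y`, `z` are the barycentric coordinates at the other three vertices. -/
lemma midCenter_power_identity {a b c d D : ℝ} (ha : 0 < a) (hb : 0 < b) (hc : 0 < c) (hd : 0 < d)
    (hD : D = (a⁻¹ + b⁻¹ + c⁻¹ + d⁻¹) ^ 2 - 2 * (a⁻¹ ^ 2 + b⁻¹ ^ 2 + c⁻¹ ^ 2 + d⁻¹ ^ 2))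
    (hD0 : D ≠ 0) {K x y z : ℝ} (hK : K = a⁻¹ + b⁻¹ + c⁻¹ + d⁻¹)
    (hx : x = b⁻¹ * (K - 2 * b⁻¹) / D) (hy : y = c⁻¹ * (K - 2 * c⁻¹) / D)
    (hz : z = d⁻¹ * (K - 2 * d⁻¹) / D) :
    (x + y + z) * (x * (a + b) ^ 2 + y * (a + c) ^ 2 + z * (a + d) ^ 2) - x * y * (b + c) ^ 2
      - x * z * (b + d) ^ 2 - y * z * (c + d) ^ 2 = a ^ 2 + 4 / D := by
  subst hx hy hz hK
  rw [show a ^ 2 + 4 / D = (a ^ 2 * D ^ 2 + 4 * D) / D ^ 2 by field_simp,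
    eq_div_iff (by positivity)]
  field_simp
  rw [hD]
  field_simp
  ring

/-- The squared distance from the centre of the tetrahedron to the incentre of the face with radii
`a`, `b`, `c`, as a difference of powers; `y` is the barycentric coordinate at the fourth vertex. -/
lemma face_power_identity {a b c d D K y : ℝ} (ha : 0 < a) (hb : 0 < b) (hc : 0 < c) (hd : 0 < d)
    (hD : D = (a⁻¹ + b⁻¹ + c⁻¹ + d⁻¹) ^ 2 - 2 * (a⁻¹ ^ 2 + b⁻¹ ^ 2 + c⁻¹ ^ 2 + d⁻¹ ^ 2))
    (hD0 : D ≠ 0) (hK : K = a⁻¹ + b⁻¹ + c⁻¹ + d⁻¹) (hy : y = d⁻¹ * (K - 2 * d⁻¹) / D) :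
    4 / D - a * b * c / (a + b + c) =
      y ^ 2 * (D * (a * b * c * d) * d / (a + b + c)) := by
  subst hy hK
  rw [show a * b * c / (a + b + c) = a * b * c / (a + b + c) * D / D by field_simp]
  field_simp
  rw [hD]
  field_simp
  ring

/-- The terms of the expansion of `minorPoly` that involve only two of the four face weights, for
faces opposite to vertices of radii `x`, `x'`, with half-perimeters `s`, `s'` and numerators `n`,
`n'` of the weights. -/
def pairCoeff (n x s n' x' s' : ℝ) : ℝ := n * n' * (x + x') * (n * (s' + x) + n' * (s + x'))

/-- The coefficient, in the expansion of `minorPoly`, of the product of the weights of the three faces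
opposite to the vertices of radii `a`, `b`, `c`. -/
def tripleCoeff (a b c d : ℝ) : ℝ :=
  2 * ((a + b) * (b + c) * (a + c)) + (a + c) * (b + c) * (a + b + 2 * d) +
    (a + b) * (b + c) * (a + c + 2 * d) + (a + b) * (a + c) * (b + c + 2 * d) +
    (a + c) * (b + d) * (a + c + 2 * d) + (a + b) * (c + d) * (a + b + 2 * d) +
    (b + c) * (a + d) * (b + c + 2 * d)

/-- The determinant of the Laplacian of the complete graph on four vertices with the row and column
of vertex `0` removed, as a polynomial in the six edge weights. -/
def minorPoly (w01 w02 w03 w12 w13 w23 : ℝ) : ℝ :=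
  (w01 + w12 + w13) * ((w02 + w12 + w23) * (w03 + w13 + w23) - w23 ^ 2)
    - w12 * (w12 * (w03 + w13 + w23) + w23 * w13) - w13 * (w12 * w23 + w13 * (w02 + w12 + w23))

/-- Each edge weight is the sum of the contributions of the two faces at that edge. As the spanning
trees of a face with edge weights `1 / (a + b)` etc. have total weight
`2 (a + b + c) / ((a + b) (b + c) (c + a))`, one factor for each half-perimeter suffices to clear
the denominators of the face weights; this keeps the degree of `coeff_identity` low. -/
lemma minorPoly_expand {a b c d : ℝ} (ha : 0 < a) (hb : 0 < b) (hc : 0 < c) (hd : 0 < d)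
    (m0 m1 m2 m3 : ℝ) {s0 s1 s2 s3 : ℝ} (h0 : s0 = b + c + d) (h1 : s1 = a + c + d)
    (h2 : s2 = a + b + d) (h3 : s3 = a + b + c) :
    minorPoly ((m2 + m3) / (a + b)) ((m1 + m3) / (a + c)) ((m1 + m2) / (a + d))
        ((m0 + m3) / (b + c)) ((m0 + m2) / (b + d)) ((m0 + m1) / (c + d)) *
      ((a + b) * (a + c) * (a + d) * (b + c) * (b + d) * (c + d)) * (s0 * s1 * s2 * s3) =
    2 * (s2 * s3 * pairCoeff (m0 * s0) a s0 (m1 * s1) b s1 +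
        s1 * s3 * pairCoeff (m0 * s0) a s0 (m2 * s2) c s2 +
        s1 * s2 * pairCoeff (m0 * s0) a s0 (m3 * s3) d s3 +
        s0 * s3 * pairCoeff (m1 * s1) b s1 (m2 * s2) c s2 +
        s0 * s2 * pairCoeff (m1 * s1) b s1 (m3 * s3) d s3 +
        s0 * s1 * pairCoeff (m2 * s2) c s2 (m3 * s3) d s3) +
      (m0 * s0) * (m1 * s1) * (m2 * s2) * tripleCoeff a b c d * s3 +
      (m0 * s0) * (m1 * s1) * (m3 * s3) * tripleCoeff a b d c * s2 +
      (m0 * s0) * (m2 * s2) * (m3 * s3) * tripleCoeff a c d b * s1 +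
      (m1 * s1) * (m2 * s2) * (m3 * s3) * tripleCoeff b c d a * s0 := by
  have key : minorPoly ((m2 + m3) / (a + b)) ((m1 + m3) / (a + c)) ((m1 + m2) / (a + d))
        ((m0 + m3) / (b + c)) ((m0 + m2) / (b + d)) ((m0 + m1) / (c + d)) *
      ((a + b) * (a + c) * (a + d) * (b + c) * (b + d) * (c + d)) =
      2 * (m0 * m1 * (a + b) * (m0 * s0 * (s1 + a) + m1 * s1 * (s0 + b)) +
        m0 * m2 * (a + c) * (m0 * s0 * (s2 + a) + m2 * s2 * (s0 + c)) +
        m0 * m3 * (a + d) * (m0 * s0 * (s3 + a) + m3 * s3 * (s0 + d)) +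
        m1 * m2 * (b + c) * (m1 * s1 * (s2 + b) + m2 * s2 * (s1 + c)) +
        m1 * m3 * (b + d) * (m1 * s1 * (s3 + b) + m3 * s3 * (s1 + d)) +
        m2 * m3 * (c + d) * (m2 * s2 * (s3 + c) + m3 * s3 * (s2 + d))) +
      m0 * m1 * m2 * tripleCoeff a b c d + m0 * m1 * m3 * tripleCoeff a b d c +
      m0 * m2 * m3 * tripleCoeff a c d b + m1 * m2 * m3 * tripleCoeff b c d a := by
    subst h0 h1 h2 h3
    simp only [minorPoly, tripleCoeff]
    field_simp
    ring
  rw [key]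
  simp only [pairCoeff]
  ring

lemma coeff_identity {a b c d D K n0 n1 n2 n3 : ℝ} (ha : 0 < a) (hb : 0 < b) (hc : 0 < c)
    (hd : 0 < d)
    (hD : D = (a⁻¹ + b⁻¹ + c⁻¹ + d⁻¹) ^ 2 - 2 * (a⁻¹ ^ 2 + b⁻¹ ^ 2 + c⁻¹ ^ 2 + d⁻¹ ^ 2))
    (hK : K = a⁻¹ + b⁻¹ + c⁻¹ + d⁻¹)
    (hn0 : n0 = a⁻¹ * (K - 2 * a⁻¹)) (hn1 : n1 = b⁻¹ * (K - 2 * b⁻¹))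
    (hn2 : n2 = c⁻¹ * (K - 2 * c⁻¹)) (hn3 : n3 = d⁻¹ * (K - 2 * d⁻¹))
    {s0 s1 s2 s3 : ℝ} (h0 : s0 = b + c + d) (h1 : s1 = a + c + d)
    (h2 : s2 = a + b + d) (h3 : s3 = a + b + c) :
    2 * (s2 * s3 * pairCoeff n0 a s0 n1 b s1 + s1 * s3 * pairCoeff n0 a s0 n2 c s2 +
        s1 * s2 * pairCoeff n0 a s0 n3 d s3 + s0 * s3 * pairCoeff n1 b s1 n2 c s2 +
        s0 * s2 * pairCoeff n1 b s1 n3 d s3 + s0 * s1 * pairCoeff n2 c s2 n3 d s3) +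
      n0 * n1 * n2 * tripleCoeff a b c d * s3 + n0 * n1 * n3 * tripleCoeff a b d c * s2 +
      n0 * n2 * n3 * tripleCoeff a c d b * s1 + n1 * n2 * n3 * tripleCoeff b c d a * s0 =
    6 * D ^ 2 / (a * b * c * d) *
      ((a + b) * (a + c) * (a + d) * (b + c) * (b + d) * (c + d)) := by
  simp only [pairCoeff, tripleCoeff]
  subst hD hn0 hn1 hn2 hn3 hK h0 h1 h2 h3
  field_simp
  ring

lemma minorPoly_eq {a b c d D K m0 m1 m2 m3 : ℝ} (ha : 0 < a) (hb : 0 < b) (hc : 0 < c)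
    (hd : 0 < d)
    (hD : D = (a⁻¹ + b⁻¹ + c⁻¹ + d⁻¹) ^ 2 - 2 * (a⁻¹ ^ 2 + b⁻¹ ^ 2 + c⁻¹ ^ 2 + d⁻¹ ^ 2))
    (hK : K = a⁻¹ + b⁻¹ + c⁻¹ + d⁻¹)
    (h0 : m0 = a⁻¹ * (K - 2 * a⁻¹) / (b + c + d)) (h1 : m1 = b⁻¹ * (K - 2 * b⁻¹) / (a + c + d))
    (h2 : m2 = c⁻¹ * (K - 2 * c⁻¹) / (a + b + d)) (h3 : m3 = d⁻¹ * (K - 2 * d⁻¹) / (a + b + c)) :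
    minorPoly ((m2 + m3) / (a + b)) ((m1 + m3) / (a + c)) ((m1 + m2) / (a + d))
        ((m0 + m3) / (b + c)) ((m0 + m2) / (b + d)) ((m0 + m1) / (c + d)) =
      6 * D ^ 2 / (a * b * c * d) /
        ((b + c + d) * (a + c + d) * (a + b + d) * (a + b + c)) := by
  have hA := minorPoly_expand ha hb hc hd m0 m1 m2 m3 rfl rfl rfl rfl
  rw [coeff_identity ha hb hc hd hD hK (by rw [h0]; field_simp) (by rw [h1]; field_simp)
    (by rw [h2]; field_simp) (by rw [h3]; field_simp) rfl rfl rfl rfl] at hA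
  rw [eq_div_iff (by positivity)]
  have hp : (a + b) * (a + c) * (a + d) * (b + c) * (b + d) * (c + d) ≠ 0 := by positivity
  apply mul_right_cancel₀ hp
  rw [← hA]
  ring

/-! ### Barycentric coordinates of the centres -/

lemma sum_eq_of_nodup {M : Type*} [AddCommMonoid M] {i j k l : Fin 4} (h : [i, j, k, l].Nodup)
    (f : Fin 4 → M) : ∑ m, f m = f i + f j + f k + f l := by
  have hu : (Finset.univ : Finset (Fin 4)) = [i, j, k, l].toFinset := by
    revert i j k l; decide
  rw [hu, List.sum_toFinset f h]
  simp [add_assoc]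

lemma exists_nodup (i : Fin 4) : ∃ j k l, [i, j, k, l].Nodup := by
  revert i; decide

/-- The squared distance from a point given by barycentric coordinates to a vertex, in terms of the
lengths of the edges. -/
lemma dist_sq_linearCombination (x y z u : Space) {a b c d : ℝ} (h : a + b + c + d = 1) :
    dist (a • x + b • y + c • z + d • u) x ^ 2 =
      (b + c + d) * (b * dist x y ^ 2 + c * dist x z ^ 2 + d * dist x u ^ 2)
        - b * c * dist y z ^ 2 - b * d * dist y u ^ 2 - c * d * dist z u ^ 2 := by
  obtain rfl : a = 1 - b - c - d := by linarith
  have h : ∀ p : Space, dist p x ^ 2 = inner ℝ (p - x) (p - x) := fun p => by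
    rw [dist_eq_norm, real_inner_self_eq_norm_sq]
  rw [h, show (1 - b - c - d) • x + b • y + c • z + d • u - x =
    b • (y - x) + c • (z - x) + d • (u - x) by module]
  have e : ∀ p q : Space, dist p q ^ 2 = inner ℝ (p - x) (p - x) - 2 * inner ℝ (p - x) (q - x) +
      inner ℝ (q - x) (q - x) := fun p q => by
    rw [dist_eq_norm, ← sub_sub_sub_cancel_right p q x, norm_sub_sq_real,
      real_inner_self_eq_norm_sq, real_inner_self_eq_norm_sq]
  rw [e x y, e x z, e x u, e y z, e y u, e z u]
  simp only [inner_add_left, inner_add_right, inner_smul_left, inner_smul_right, sub_self,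
    inner_zero_left, real_inner_comm, RCLike.conj_to_real]
  ring

/-- Descartes' quadratic form `(∑ κ)² - 2 ∑ κ²` in the curvatures `κ = 1 / r` of four pairwise
tangent spheres. -/
def curvatureForm (r : Fin 4 → ℝ) : ℝ := (∑ i, (r i)⁻¹) ^ 2 - 2 * ∑ i, (r i)⁻¹ ^ 2

/-- The barycentric coordinates of the centre of the sphere tangent to the six edges. -/
def midWeight (r : Fin 4 → ℝ) (i : Fin 4) : ℝ :=
  (r i)⁻¹ * ((∑ j, (r j)⁻¹) - 2 * (r i)⁻¹) / curvatureForm r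

/-- The centre of the sphere tangent to the six edges: the radical centre of the four spheres. -/
def midCenter (v : Fin 4 → Space) (r : Fin 4 → ℝ) : Space := ∑ i, midWeight r i • v i

/-- The point of tangency of the spheres `i` and `j`. -/
def edgePoint (v : Fin 4 → Space) (r : Fin 4 → ℝ) (i j : Fin 4) : Space :=
  (r j / (r i + r j)) • v i + (r i / (r i + r j)) • v j

/-- The incentre of the face `[i,j,k]`, given by the side lengths as barycentric coordinates. -/
def faceIncenter (v : Fin 4 → Space) (r : Fin 4 → ℝ) (i j k : Fin 4) : Space :=
  ((r j + r k) / (2 * (r i + r j + r k))) • v i + ((r k + r i) / (2 * (r i + r j + r k))) • v j +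
    ((r i + r j) / (2 * (r i + r j + r k))) • v k

lemma curvatureForm_eq {i j k l : Fin 4} (h : [i, j, k, l].Nodup) (r : Fin 4 → ℝ) :
    curvatureForm r = ((r i)⁻¹ + (r j)⁻¹ + (r k)⁻¹ + (r l)⁻¹) ^ 2 -
      2 * ((r i)⁻¹ ^ 2 + (r j)⁻¹ ^ 2 + (r k)⁻¹ ^ 2 + (r l)⁻¹ ^ 2) := by
  rw [curvatureForm, sum_eq_of_nodup h, sum_eq_of_nodup h]

lemma sum_midWeight {r : Fin 4 → ℝ} (hD : curvatureForm r ≠ 0) : ∑ i, midWeight r i = 1 := by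
  simp only [midWeight, ← Finset.sum_div]
  rw [div_eq_one_iff_eq hD, curvatureForm]
  have e : ∀ i, (r i)⁻¹ * ((∑ j, (r j)⁻¹) - 2 * (r i)⁻¹) =
      (r i)⁻¹ * (∑ j, (r j)⁻¹) - 2 * (r i)⁻¹ ^ 2 := fun i => by ring
  simp only [e, Finset.sum_sub_distrib, ← Finset.sum_mul, ← Finset.mul_sum, sq]

lemma faceIncenter_rotate (v : Fin 4 → Space) (r : Fin 4 → ℝ) (i j k : Fin 4) :
    faceIncenter v r j k i = faceIncenter v r i j k := by
  rw [faceIncenter, faceIncenter, show r j + r k + r i = r i + r j + r k by ring]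
  abel

section
variable {v : Fin 4 → Space} {r : Fin 4 → ℝ}

lemma affineComb_mem_faceSpan {σ : Finset (Fin 4)} {i j : Fin 4} (hi : i ∈ σ) (hj : j ∈ σ)
    (t : ℝ) {y : Space} (hy : y ∈ faceSpan v σ) : t • (v j - v i) + y ∈ faceSpan v σ :=
  AffineSubspace.smul_vsub_vadd_mem _ t (vertex_mem_faceSpan v hj) (vertex_mem_faceSpan v hi) hy

variable (hr : ∀ i, 0 < r i) (hd : ∀ i j, i ≠ j → dist (v i) (v j) = r i + r j)
include hr

lemma edgePoint_eq (i j : Fin 4) :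
    edgePoint v r i j = (r i / (r i + r j)) • (v j - v i) + v i := by
  have hi := hr i
  have hj := hr j
  have : r j / (r i + r j) = 1 - r i / (r i + r j) := by field_simp; ring
  rw [edgePoint, this]
  module

lemma edgePoint_mem (i j : Fin 4) : edgePoint v r i j ∈ faceSpan v {i, j} := by
  rw [edgePoint_eq hr]
  exact affineComb_mem_faceSpan (by simp) (by simp) _ (vertex_mem_faceSpan v (by simp))

lemma faceIncenter_eq (i j k : Fin 4) :
    faceIncenter v r i j k = ((r i + r j) / (2 * (r i + r j + r k))) • (v k - v i) +
      (((r k + r i) / (2 * (r i + r j + r k))) • (v j - v i) + v i) := by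
  have hi := hr i
  have hj := hr j
  have hk := hr k
  have : (r j + r k) / (2 * (r i + r j + r k)) = 1 - (r i + r j) / (2 * (r i + r j + r k)) -
    (r k + r i) / (2 * (r i + r j + r k)) := by field_simp; ring
  rw [faceIncenter, this]
  module

lemma faceIncenter_mem (i j k : Fin 4) : faceIncenter v r i j k ∈ faceSpan v {i, j, k} := by
  rw [faceIncenter_eq hr]
  exact affineComb_mem_faceSpan (by simp) (by simp) _
    (affineComb_mem_faceSpan (by simp) (by simp) _ (vertex_mem_faceSpan v (by simp)))

omit hr in
lemma midCenter_eq (hD : curvatureForm r ≠ 0) {i j k l : Fin 4} (h : [i, j, k, l].Nodup) :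
    midCenter v r = midWeight r l • (v l - v i) +
      (midWeight r k • (v k - v i) + (midWeight r j • (v j - v i) + v i)) := by
  have hs := sum_midWeight hD
  rw [sum_eq_of_nodup h] at hs
  rw [midCenter, sum_eq_of_nodup h, show midWeight r i = 1 - midWeight r j - midWeight r k -
    midWeight r l by linarith]
  module

include hd

lemma edgePoint_hasPower {i j : Fin 4} (h : i ≠ j) :
    HasPower v r {i, j} (edgePoint v r i j) 0 := by
  have key : ∀ i j : Fin 4, i ≠ j → dist (edgePoint v r i j) (v i) ^ 2 = r i ^ 2 + 0 := by
    intro i j h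
    have hi := hr i
    have hj := hr j
    rw [edgePoint_eq hr, dist_eq_norm, add_sub_cancel_right, norm_smul, ← dist_eq_norm,
      dist_comm, hd i j h, Real.norm_of_nonneg (by positivity)]
    field_simp
    ring
  intro m hm
  rcases Finset.mem_insert.1 hm with rfl | hm
  · exact key _ _ h
  · rw [Finset.mem_singleton] at hm
    subst hm
    have := key _ _ h.symm
    rwa [edgePoint, add_comm, add_comm (r m)] at this

/-- The power is the squared inradius: the incircle meets the edges at the points of tangency of the
spheres. -/
lemma faceIncenter_hasPower {i j k : Fin 4} (hij : i ≠ j) (hik : i ≠ k) (hjk : j ≠ k) :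
    HasPower v r {i, j, k} (faceIncenter v r i j k) (r i * r j * r k / (r i + r j + r k)) := by
  have key : ∀ i j k : Fin 4, i ≠ j → i ≠ k → j ≠ k → dist (faceIncenter v r i j k) (v i) ^ 2 =
      r i ^ 2 + r i * r j * r k / (r i + r j + r k) := by
    intro i j k hij hik hjk
    have hi := hr i
    have hj := hr j
    have hk := hr k
    have := dist_sq_linearCombination (v i) (v j) (v k) (v i)
      (a := (r j + r k) / (2 * (r i + r j + r k))) (b := (r k + r i) / (2 * (r i + r j + r k)))
      (c := (r i + r j) / (2 * (r i + r j + r k))) (d := 0) (by field_simp; ring)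
    rw [zero_smul, add_zero] at this
    rw [faceIncenter, this, hd i j hij, hd i k hik, hd j k hjk]
    field_simp
    ring
  intro m hm
  simp only [Finset.mem_insert, Finset.mem_singleton] at hm
  rcases hm with rfl | rfl | rfl
  · exact key _ _ _ hij hik hjk
  · rw [← faceIncenter_rotate, key _ _ _ hjk hij.symm hik.symm]
    congr 2 <;> ring
  · rw [← faceIncenter_rotate, ← faceIncenter_rotate, key _ _ _ hik.symm hjk.symm hij]
    congr 2 <;> ring

lemma midCenter_hasPower (hD : curvatureForm r ≠ 0) :
    HasPower v r Finset.univ (midCenter v r) (4 / curvatureForm r) := by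
  intro i _
  obtain ⟨j, k, l, h⟩ := exists_nodup i
  have hs := sum_midWeight hD
  rw [sum_eq_of_nodup h] at hs
  have h' := h
  simp only [List.nodup_cons, List.mem_cons, not_or, List.not_mem_nil, or_false] at h'
  obtain ⟨⟨hij, hik, hil⟩, ⟨hjk, hjl⟩, hkl, -⟩ := h'
  rw [midCenter, sum_eq_of_nodup h, dist_sq_linearCombination _ _ _ _ hs, hd i j hij, hd i k hik,
    hd i l hil, hd j k hjk, hd j l hjl, hd k l hkl]
  exact midCenter_power_identity (hr i) (hr j) (hr k) (hr l) (curvatureForm_eq h r) hD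
    (sum_eq_of_nodup h _) rfl rfl rfl

lemma gram_det_eq :
    (Matrix.gram ℝ fun i : Fin 3 => v i.succ - v 0).det =
      4 * (∏ i, r i) ^ 2 * curvatureForm r := by
  have e : ∀ i j : Fin 3, inner ℝ (v i.succ - v 0) (v j.succ - v 0) =
      (dist (v i.succ) (v 0) ^ 2 + dist (v j.succ) (v 0) ^ 2 - dist (v i.succ) (v j.succ) ^ 2) / 2 :=
    fun i j => by
    rw [real_inner_eq_norm_mul_self_add_norm_mul_self_sub_norm_sub_mul_self_div_two,
      sub_sub_sub_cancel_right, dist_eq_norm, dist_eq_norm, dist_eq_norm]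
    ring
  have h0 := hr 0
  have h1 := hr 1
  have h2 := hr 2
  have h3 := hr 3
  rw [Matrix.det_fin_three, curvatureForm_eq (i := 0) (j := 1) (k := 2) (l := 3) (by decide),
    Fin.prod_univ_four]
  simp only [Matrix.gram_apply, e]
  simp only [Fin.succ_zero_eq_one, Fin.succ_one_eq_two, show (2 : Fin 3).succ = 3 from rfl,
    dist_self]
  rw [hd 1 0 (by decide), hd 2 0 (by decide), hd 3 0 (by decide), hd 1 2 (by decide),
    hd 1 3 (by decide), hd 2 1 (by decide), hd 2 3 (by decide), hd 3 1 (by decide),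
    hd 3 2 (by decide)]
  field_simp
  ring

lemma curvatureForm_pos (hT : AffineIndependent ℝ v) : 0 < curvatureForm r := by
  have hli : LinearIndependent ℝ fun i : Fin 3 => v i.succ - v 0 :=
    ((affineIndependent_iff_linearIndependent_vsub ℝ v 0).1 hT).comp
      (fun i : Fin 3 => ⟨i.succ, Fin.succ_ne_zero i⟩)
      fun i j hij => Fin.succ_injective _ (congrArg Subtype.val hij)
  have hpos := (Matrix.posDef_gram_of_linearIndependent hli).det_pos
  rw [gram_det_eq hr hd] at hpos
  have : 0 ≤ 4 * (∏ i, r i) ^ 2 := by positivity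
  exact pos_of_mul_pos_right hpos this

lemma tetVolume_eq (hT : AffineIndependent ℝ v) :
    tetVolume v = (∏ i, r i) * √(curvatureForm r) / 3 := by
  have h := tetVolume_sq v
  have hD := curvatureForm_pos hr hd hT
  have hP : 0 < ∏ i, r i := Finset.prod_pos fun i _ => hr i
  change _ = (Matrix.gram ℝ fun i : Fin 3 => v i.succ - v 0).det at h
  rw [gram_det_eq hr hd] at h
  have h0 : 0 ≤ tetVolume v := MeasureTheory.measureReal_nonneg
  rw [← sq_eq_sq₀ h0 (by positivity), div_pow, mul_pow, Real.sq_sqrt hD.le]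
  linarith

end

/-! ### The midsphere and the edge weights -/

section
variable {v : Fin 4 → Space} {r : Fin 4 → ℝ} (hr : ∀ i, 0 < r i)
  (hd : ∀ i j, i ≠ j → dist (v i) (v j) = r i + r j) (hT : AffineIndependent ℝ v)

lemma midCenter_mem {σ : Finset (Fin 4)} (hσ : σ = Finset.univ) (hD : curvatureForm r ≠ 0) :
    midCenter v r ∈ faceSpan v σ := by
  subst hσ
  rw [midCenter_eq hD (i := 0) (j := 1) (k := 2) (l := 3) (by decide)]
  iterate 3 refine affineComb_mem_faceSpan (Finset.mem_univ _) (Finset.mem_univ _) _ ?_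
  exact vertex_mem_faceSpan v (Finset.mem_univ _)

lemma eq_of_hasPower_univ {p q : Space} {c c' : ℝ} (hp : HasPower v r Finset.univ p c)
    (hq : HasPower v r Finset.univ q c') (hpσ : p ∈ faceSpan v Finset.univ)
    (hqσ : q ∈ faceSpan v Finset.univ) : p = q ∧ c = c' := by
  have h := hp.dist_sq_eq Finset.univ_nonempty hq hpσ
  have h' := hq.dist_sq_eq Finset.univ_nonempty hp hqσ
  have h0 := sq_nonneg (dist q p)
  rw [dist_comm] at h'
  have hc : c = c' := by linarith
  rw [hc, sub_self, sq_eq_zero_iff, dist_eq_zero] at h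
  exact ⟨h.symm, hc⟩

lemma faceSpan_univ (hT : AffineIndependent ℝ v) : faceSpan v Finset.univ = ⊤ := by
  rw [faceSpan, Finset.coe_univ, Set.image_univ, hT.affineSpan_eq_top_iff_card_eq_finrank_add_one]
  simp

include hd in
/-- Any sphere tangent to the edges has its centre at the radical centre: the tangent lengths `t i`
from the vertices satisfy `t i + t j = r i + r j` for all pairs, hence equal the radii. -/
lemma hasPower_of_isEdgeTangentSphere {M : Sphere Space} (hM : IsEdgeTangentSphere v M) :
    HasPower v r Finset.univ M.center (M.radius ^ 2) := by
  choose! q hq htan using hM.2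
  have hl : ∀ i j, v i ∈ line[ℝ, v i, v j] := fun i j => left_mem_affineSpan_pair ℝ _ _
  have hl' : ∀ i j, v j ∈ line[ℝ, v i, v j] := fun i j => right_mem_affineSpan_pair ℝ _ _
  have hlen : ∀ i j, i ≠ j → dist (v i) (q i j) + dist (v j) (q i j) = r i + r j := by
    intro i j hij
    rw [dist_comm (v j), dist_add_dist_of_mem_segment (hq i j hij), hd i j hij]
  have hsame : ∀ i j i' j' m, i ≠ j → i' ≠ j' → v m ∈ line[ℝ, v i, v j] →
      v m ∈ line[ℝ, v i', v j'] → dist (v m) (q i j) = dist (v m) (q i' j') :=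
    fun i j i' j' m h h' hm hm' => (htan i j h).dist_eq_of_mem_of_mem (htan i' j' h') hm hm'
  intro i _
  obtain ⟨j, k, l, h⟩ := exists_nodup i
  simp only [List.nodup_cons, List.mem_cons, not_or, List.not_mem_nil, or_false] at h
  obtain ⟨⟨hij, hik, -⟩, ⟨hjk, -⟩, -⟩ := h
  -- In the triangle `i j k` the three tangent lengths solve the same linear system as the radii.
  have hi : dist (v i) (q i j) = r i := by
    have e1 := hsame i j i k i hij hik (hl _ _) (hl _ _)
    have e2 := hsame i j j k j hij hjk (hl' _ _) (hl _ _)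
    have e3 := hsame i k j k k hik hjk (hl' _ _) (hl' _ _)
    linarith [hlen i j hij, hlen i k hik, hlen j k hjk]
  rw [dist_comm, (htan i j hij).dist_sq_eq_of_mem (hl i j), hi]
  ring

include hr hd hT

lemma eq_midsphere {M : Sphere Space} (hM : IsEdgeTangentSphere v M) :
    M.center = midCenter v r ∧ M.radius ^ 2 = 4 / curvatureForm r :=
  have hD := (curvatureForm_pos hr hd hT).ne'
  eq_of_hasPower_univ (hasPower_of_isEdgeTangentSphere hd hM) (midCenter_hasPower hr hd hD)
    (by rw [faceSpan_univ hT]; trivial) (midCenter_mem rfl hD)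

lemma isEdgeTangentSphere_midsphere :
    IsEdgeTangentSphere v ⟨midCenter v r, √(4 / curvatureForm r)⟩ := by
  have hD := curvatureForm_pos hr hd hT
  have hC := midCenter_hasPower hr hd hD.ne'
  refine ⟨Real.sqrt_pos.2 (by positivity), fun i j hij => ⟨edgePoint v r i j, ?_, ?_, ?_, ?_⟩⟩
  · have hi := hr i
    have hj := hr j
    exact ⟨_, _, by positivity, by positivity, by field_simp; ring, rfl⟩
  · have h := (edgePoint_hasPower hr hd hij).dist_sq_eq (by simp) (hC.mono (Finset.subset_univ _))
      (edgePoint_mem hr i j)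
    rw [mem_sphere, dist_comm, ← Real.sqrt_sq (dist_nonneg (x := midCenter v r)), h, sub_zero]
  · simpa [faceSpan, Set.image_pair] using edgePoint_mem (v := v) hr i j
  · intro x hx
    have h := ((edgePoint_hasPower hr hd hij).sub_mem_direction_orthogonal
      (hC.mono (Finset.subset_univ _)))
    rw [Sphere.mem_orthRadius_iff_inner_left]
    refine (Submodule.mem_orthogonal _ _).1 h _ (AffineSubspace.vsub_mem_direction ?_
      (edgePoint_mem hr i j))
    simpa [faceSpan, Set.image_pair] using hx

/-- Inradius of a face times signed height of the centre over it. Both are square roots, and their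
product is rational in the radii up to the single root `√(curvatureForm r)`. -/
lemma dualLength_mul_dualLength {i j k l : Fin 4} (h : [i, j, k, l].Nodup) :
    dualLength v (midCenter v r) {i, j} {i, j, k} *
        dualLength v (midCenter v r) {i, j, k} Finset.univ =
      midWeight r l * ((∏ m, r m) * √(curvatureForm r)) / (r i + r j + r k) := by
  have hD := curvatureForm_pos hr hd hT
  have hC := midCenter_hasPower hr hd hD.ne'
  have hu : (Finset.univ : Finset (Fin 4)) = insert l {i, j, k} := by
    clear * - h
    revert i j k l; decide
  have hP : ∏ m, r m = r i * r j * r k * r l := by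
    have := congrArg Multiplicative.toAdd
      (sum_eq_of_nodup h fun m => Additive.ofMul (r m))
    exact this
  have h' := h
  simp only [List.nodup_cons, List.mem_cons, not_or, List.not_mem_nil, or_false] at h'
  obtain ⟨⟨hij, hik, hil⟩, ⟨hjk, hjl⟩, hkl, -⟩ := h'
  have hi := hr i
  have hj := hr j
  have hk := hr k
  have hl := hr l
  set s := r i + r j + r k
  set D := curvatureForm r
  have hspos : 0 < s := by positivity
  have hI := faceIncenter_hasPower hr hd hij hik hjk
  have hImem := faceIncenter_mem (v := v) hr i j k
  -- The dual length here is the inradius, written as a multiple of the barycentric coordinate of the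
  -- incentre at `v k`.
  have h1 : dualLength v (midCenter v r) {i, j} {i, j, k} =
      (r i + r j) / (2 * s) * (√(r i * r j * r k / s) / ((r i + r j) / (2 * s))) := by
    refine dualLength_eq hT (k := k) (by simp [Ne.symm hik, Ne.symm hjk]) (by simp)
      (by ext; simp; tauto) (hC.mono (Finset.subset_univ _)) hI hImem
      (edgePoint_hasPower hr hd hij) (edgePoint_mem hr i j)
      (vertex_mem_faceSpan v (i := i) (by simp))
      (affineComb_mem_faceSpan (by simp) (by simp) _ (vertex_mem_faceSpan v (by simp)))
      (faceIncenter_eq hr i j k) (by positivity) ?_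
    rw [mul_div_cancel₀ _ (by positivity), Real.sq_sqrt (by positivity), sub_zero]
  have h2 : dualLength v (midCenter v r) {i, j, k} Finset.univ =
      midWeight r l * √(D * (r i * r j * r k * r l) * r l / s) := by
    refine dualLength_eq hT (k := l) (by simp [Ne.symm hil, Ne.symm hjl, Ne.symm hkl]) (by simp)
      hu hC hC (midCenter_mem rfl hD.ne') hI hImem
      (vertex_mem_faceSpan v (i := i) (by simp))
      (affineComb_mem_faceSpan (by simp) (by simp) _
        (affineComb_mem_faceSpan (by simp) (by simp) _ (vertex_mem_faceSpan v (by simp))))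
      (midCenter_eq hD.ne' h) (by positivity) ?_
    rw [mul_pow, Real.sq_sqrt (by positivity)]
    exact face_power_identity hi hj hk hl (curvatureForm_eq h r) hD.ne' (sum_eq_of_nodup h _) rfl
  have h3 : √(r i * r j * r k / s) * √(D * (r i * r j * r k * r l) * r l / s) =
      (r i * r j * r k * r l) * √D / s := by
    rw [← Real.sqrt_mul (by positivity), show r i * r j * r k / s *
      (D * (r i * r j * r k * r l) * r l / s) = (r i * r j * r k * r l / s) ^ 2 * D by
        field_simp, Real.sqrt_mul (by positivity), Real.sqrt_sq (by positivity)]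
    ring
  rw [h1, h2, hP, mul_div_cancel₀ _ (by positivity), mul_left_comm, h3]
  ring

/-- The contribution of the face opposite to `l` to the weights of its edges `[i,j]`, up to the factor
`1 / (r i + r j)` and a constant common to all faces. -/
def faceWeight (r : Fin 4 → ℝ) (l : Fin 4) : ℝ :=
  (r l)⁻¹ * ((∑ j, (r j)⁻¹) - 2 * (r l)⁻¹) / ((∑ m, r m) - r l)

lemma edgeWeight_eq {i j k l : Fin 4} (h : [i, j, k, l].Nodup) :
    edgeWeight v (midCenter v r) i j = (∏ m, r m) * √(curvatureForm r) / (2 * curvatureForm r) *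
      ((faceWeight r k + faceWeight r l) / (r i + r j)) := by
  have h' : [i, j, l, k].Nodup := by
    clear * - h
    revert i j k l; decide
  have hu : (Finset.univ : Finset (Fin 4)) \ {i, j} = {k, l} := by
    clear * - h
    revert i j k l; decide
  have hij : i ≠ j := by rintro rfl; simp at h
  have hkl : k ≠ l := by rintro rfl; simp at h
  rw [edgeWeight, dualArea, hu, Finset.sum_pair hkl, dualLength_mul_dualLength hr hd hT h,
    dualLength_mul_dualLength hr hd hT h', hd i j hij, faceWeight, faceWeight, midWeight, midWeight,
    sum_eq_of_nodup h r, show r i + r j + r k + r l - r k = r i + r j + r l by ring,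
    show r i + r j + r k + r l - r l = r i + r j + r k by ring]
  ring

omit hr hd hT in
lemma edgeWeight_comm (v : Fin 4 → Space) (C : Space) (i j : Fin 4) :
    edgeWeight v C i j = edgeWeight v C j i := by
  rw [edgeWeight, edgeWeight, dualArea, dualArea, Finset.pair_comm, dist_comm]
  simp only [Finset.insert_comm i j]

omit hr hd hT in
lemma laplacianDet_eq_minorPoly (v : Fin 4 → Space) (C : Space) :
    laplacianDet v C = minorPoly (edgeWeight v C 0 1) (edgeWeight v C 0 2) (edgeWeight v C 0 3)
      (edgeWeight v C 1 2) (edgeWeight v C 1 3) (edgeWeight v C 2 3) := by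
  rw [laplacianDet, Matrix.det_fin_three]
  simp [laplacian, show (2 : Fin 3).succ = 3 from rfl, Fin.sum_univ_four, edgeWeight_comm v C 1 0,
    edgeWeight_comm v C 2 0, edgeWeight_comm v C 3 0, edgeWeight_comm v C 2 1,
    edgeWeight_comm v C 3 1, edgeWeight_comm v C 3 2, minorPoly]
  ring

lemma laplacianDet_midCenter :
    laplacianDet v (midCenter v r) = 36 * r 0 * r 1 * r 2 * r 3 * tetVolume v /
      (perimeter v 1 2 3 * perimeter v 0 2 3 * perimeter v 0 1 3 * perimeter v 0 1 2) := by
  have hD := curvatureForm_pos hr hd hT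
  have hS := sum_eq_of_nodup (i := 0) (j := 1) (k := 2) (l := 3) (by decide) r
  have hper : ∀ i j k, i ≠ j → j ≠ k → k ≠ i → perimeter v i j k = 2 * (r i + r j + r k) := by
    intro i j k hij hjk hki
    rw [perimeter, hd i j hij, hd j k hjk, hd k i hki]
    ring
  have hmul : ∀ t a b c d e f : ℝ, minorPoly (t * a) (t * b) (t * c) (t * d) (t * e) (t * f) =
      t ^ 3 * minorPoly a b c d e f := by
    intros
    simp only [minorPoly]
    ring
  have hK := sum_eq_of_nodup (i := 0) (j := 1) (k := 2) (l := 3) (by decide) fun i => (r i)⁻¹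
  have key := minorPoly_eq (hr 0) (hr 1) (hr 2) (hr 3)
    (curvatureForm_eq (i := 0) (j := 1) (k := 2) (l := 3) (by decide) r) hK
    (m0 := faceWeight r 0) (m1 := faceWeight r 1) (m2 := faceWeight r 2) (m3 := faceWeight r 3)
    (by rw [faceWeight, hS]; congr 1; ring) (by rw [faceWeight, hS]; congr 1; ring)
    (by rw [faceWeight, hS]; congr 1; ring) (by rw [faceWeight, hS]; congr 1; ring)
  rw [laplacianDet_eq_minorPoly,
    edgeWeight_eq hr hd hT (i := 0) (j := 1) (k := 2) (l := 3) (by decide),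
    edgeWeight_eq hr hd hT (i := 0) (j := 2) (k := 1) (l := 3) (by decide),
    edgeWeight_eq hr hd hT (i := 0) (j := 3) (k := 1) (l := 2) (by decide),
    edgeWeight_eq hr hd hT (i := 1) (j := 2) (k := 0) (l := 3) (by decide),
    edgeWeight_eq hr hd hT (i := 1) (j := 3) (k := 0) (l := 2) (by decide),
    edgeWeight_eq hr hd hT (i := 2) (j := 3) (k := 0) (l := 1) (by decide),
    hmul, key, tetVolume_eq hr hd hT, hper 1 2 3 (by decide) (by decide) (by decide),
    hper 0 2 3 (by decide) (by decide) (by decide),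
    hper 0 1 3 (by decide) (by decide) (by decide),
    hper 0 1 2 (by decide) (by decide) (by decide), Fin.prod_univ_four]
  have h0 := hr 0
  have h1 := hr 1
  have h2 := hr 2
  have h3 := hr 3
  -- With `√(curvatureForm r)` as a variable the identity is one of rational functions.
  obtain ⟨e, he, hDe⟩ : ∃ e : ℝ, 0 < e ∧ curvatureForm r = e ^ 2 :=
    ⟨√(curvatureForm r), Real.sqrt_pos.2 hD, (Real.sq_sqrt hD.le).symm⟩
  rw [hDe, Real.sqrt_sq he.le]
  field_simp
  ring

end

end SpherePacking

end

theorem mainTheorem4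
    (S : Fin 4 → EuclideanGeometry.Sphere SpherePacking.Space)
    (hpos : ∀ i, 0 < (S i).radius)
    (htangent : ∀ i j, i ≠ j → (S i).IsExtTangent (S j))
    (v : Fin 4 → SpherePacking.Space)
    (hv : ∀ i, v i = (S i).center)
    (hT : AffineIndependent ℝ v) :
    (∃! M : EuclideanGeometry.Sphere SpherePacking.Space,
        SpherePacking.IsEdgeTangentSphere v M) ∧
      ∀ M : EuclideanGeometry.Sphere SpherePacking.Space,
        SpherePacking.IsEdgeTangentSphere v M →
          SpherePacking.laplacianDet v M.center =
            36 * (S 0).radius * (S 1).radius * (S 2).radius * (S 3).radius *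
                SpherePacking.tetVolume v /
              (SpherePacking.perimeter v 1 2 3 * SpherePacking.perimeter v 0 2 3 *
                SpherePacking.perimeter v 0 1 3 * SpherePacking.perimeter v 0 1 2) := by
  have hd : ∀ i j, i ≠ j → dist (v i) (v j) = (S i).radius + (S j).radius := fun i j hij => by
    rw [hv, hv, (htangent i j hij).dist_center]
  refine ⟨⟨_, SpherePacking.isEdgeTangentSphere_midsphere hpos hd hT, fun M hM => ?_⟩,
    fun M hM => ?_⟩
  · obtain ⟨hc, hR⟩ := SpherePacking.eq_midsphere hpos hd hT hM
    ext1
    · exact hc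
    · exact (Real.sqrt_eq_iff_eq_sq (by rw [← hR]; positivity) hM.1.le).2 hR.symm |>.symm
  · rw [(SpherePacking.eq_midsphere hpos hd hT hM).1]
    exact SpherePacking.laplacianDet_midCenter hpos hd hT
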